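/- **Theorem.** Let $C\subset\mathbb{R}^2$ be a convex domain, that is, a filled convex polygon with nonempty interior, equipped with a (finite, face-to-face) triangulation that is non-obtuse: no angle of a triangle exceeds $\pi/2$. Suppose that $C$ is *round*: if $x$ is the center of the minimum enclosing circle of $C$, then for every vertex $v$ of the polygon $C$, all points sufficiently close to $v$ of the closed right-angled cone with apex $v$ and axis the ray from $v$ through $x$ (the points $p$ with $p=v$ or $\angle pvx\le\pi/4$) belong to $C$. Then $C$ has a *radially monotone spanning forest*, that is, a collection of pairwise disjoint trees, each made of vertices and edges of the triangulation and each containing exactly one vertex on $\partial C$ (its root), such that every vertex of the triangulation in the interior of $C$ belongs to one of the trees, and for every tree the path $(v_0,v_1,\dots,v_k)$ in the tree from any leaf $v_0$ to the root $v_k$ is radially monotone. Here a path $(v_0,\dots,v_k)$ is *radially monotone* if for each $i=0,\dots,k-1$ it is radially monotone with respect to $v_i$, meaning that the distance from $v_i$ to a point that travels along the path from $v_i$ to $v_k$ is (non-strictly) increasing, over all points of the path and not only its vertices. -/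

import Mathlib

/-- The Euclidean plane. -/
abbrev Plane : Type := EuclideanSpace ℝ (Fin 2)

/-- A convex domain: a (filled, nondegenerate) convex polygon, i.e. the convex hull of finitely many
points that has nonempty interior. -/
def IsConvexDomain (C : Set Plane) : Prop :=
  (∃ S : Finset Plane, C = convexHull ℝ (S : Set Plane)) ∧ (interior C).Nonempty

/-- `K` is a (face-to-face) triangulation of `C`: a finite simplicial complex with underlying
space `C`. -/
def IsTriangulationOf (K : Geometry.SimplicialComplex ℝ Plane) (C : Set Plane) : Prop :=
  K.faces.Finite ∧ K.space = C

/-- No triangle of `K` has an angle that exceeds a right angle. -/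
def IsNonObtuse (K : Geometry.SimplicialComplex ℝ Plane) : Prop :=
  ∀ s ∈ K.faces, ∀ a ∈ s, ∀ b ∈ s, ∀ c ∈ s, a ≠ b → b ≠ c → a ≠ c →
    EuclideanGeometry.angle a b c ≤ Real.pi / 2

/-- The circle with center `x` and radius `R` is a minimum enclosing circle of `C`. -/
def IsMinEnclosingCircle (C : Set Plane) (x : Plane) (R : ℝ) : Prop :=
  C ⊆ Metric.closedBall x R ∧ ∀ y r, C ⊆ Metric.closedBall y r → R ≤ r

/-- The in-cone at `v` of the hourglass whose baseline is tangent at `v` to the circle through `v`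
centered at `x`: the right-angled closed cone with apex `v` whose axis points towards `x`. -/
def inCone (x v : Plane) : Set Plane :=
  {p | p = v ∨ EuclideanGeometry.angle p v x ≤ Real.pi / 4}

/-- A convex domain is round if, near each of its vertices `v`, it contains the in-cone at `v`,
taken with respect to the center `x` of the minimum enclosing circle. -/
def IsRound (C : Set Plane) : Prop :=
  ∃ x R, IsMinEnclosingCircle C x R ∧
    ∀ v ∈ C.extremePoints ℝ, ∃ ε > 0, Metric.ball v ε ∩ inCone x v ⊆ C

/-- The graph of the vertices and edges of a triangulation. -/
def edgeGraph (K : Geometry.SimplicialComplex ℝ Plane) : SimpleGraph K.vertices where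
  Adj u v := u ≠ v ∧ ∃ s ∈ K.faces, (s : Set Plane) = {(u : Plane), (v : Plane)}
  symm := ⟨fun _ _ h => ⟨h.1.symm, by simpa only [Set.pair_comm] using h.2⟩⟩
  loopless := ⟨fun _ h => h.1 rfl⟩

/-- The polygonal path `v 0, v 1, …, v k` is radially monotone with respect to `v i`: along its part
from `v i` to `v k` the distance from `v i` is (non-strictly) increasing, over all points of the
path. The point with parameter `s ∈ [0, 1]` on the edge from `v j` to `v (j + 1)` precedes the point
with parameter `t` on the edge from `v l` to `v (l + 1)` if `j < l`, or `j = l` and `s ≤ t`. -/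
def IsRadiallyMonotoneWrt (v : ℕ → Plane) (k i : ℕ) : Prop :=
  ∀ j l : ℕ, ∀ s ∈ Set.Icc (0 : ℝ) 1, ∀ t ∈ Set.Icc (0 : ℝ) 1,
    i ≤ j → i ≤ l → j < k → l < k → (j < l ∨ j = l ∧ s ≤ t) →
      dist (v i) (AffineMap.lineMap (v j) (v (j + 1)) s) ≤
        dist (v i) (AffineMap.lineMap (v l) (v (l + 1)) t)

/-- The polygonal path `v 0, v 1, …, v k` is radially monotone: it is so with respect to each of
`v 0, …, v (k - 1)`. -/
def IsRadiallyMonotone (v : ℕ → Plane) (k : ℕ) : Prop :=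
  ∀ i < k, IsRadiallyMonotoneWrt v k i

/-- `T` is a radially monotone tree rooted at the boundary vertex `r`: it is a tree, `r` is its only
vertex on the boundary of `C`, and the path in `T` from every leaf to `r` is radially monotone. -/
structure IsRadiallyMonotoneTree (C : Set Plane) (K : Geometry.SimplicialComplex ℝ Plane)
    (T : (edgeGraph K).Subgraph) (r : T.verts) : Prop where
  isTree : T.coe.IsTree
  root_mem : (r : Plane) ∈ frontier C
  root_unique : ∀ w : T.verts, (w : Plane) ∈ frontier C → w = r
  monotone : ∀ v : T.verts, (∃! w : T.verts, T.coe.Adj v w) →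
    ∀ p : T.coe.Walk v r, p.IsPath →
      IsRadiallyMonotone (fun n => (p.getVert n : Plane)) p.length

/-- A radially monotone spanning forest: a collection of pairwise disjoint boundary-rooted radially
monotone trees along edges of the triangulation that span the interior vertices. -/
structure IsRadiallyMonotoneSpanningForest (C : Set Plane)
    (K : Geometry.SimplicialComplex ℝ Plane) (F : Set (edgeGraph K).Subgraph) : Prop where
  tree : ∀ T ∈ F, ∃ r : T.verts, IsRadiallyMonotoneTree C K T r
  disjoint : F.PairwiseDisjoint SimpleGraph.Subgraph.verts
  spanning : ∀ v : K.vertices, (v : Plane) ∈ interior C → ∃ T ∈ F, v ∈ T.verts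

/-! Fix one direction, the diagonal (1, 1), for all vertices. At an interior vertex the diagonal ray
enters a face whose angle there is at most π/2, so one side of that angle is within π/4 of the
diagonal, that is, in the closed first quadrant (`exists_edge_in_quadrant`). Taking such an edge as
the edge to a parent strictly increases the coordinate sum, so following parents ends on the
boundary, and the boundary vertices become the roots of disjoint trees. Along a path with all steps
in the quadrant, both coordinates relative to an earlier vertex are nonnegative and nondecreasing,
hence so is the distance to it. -/

/-- A polygonal path all of whose steps lie in the closed first quadrant is radially monotone. -/
theorem isRadiallyMonotone_of_coord_le {v : ℕ → Plane} {k : ℕ}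
    (hv : ∀ n < k, ∀ c, v n c ≤ v (n + 1) c) : IsRadiallyMonotone v k := by
  have mono : ∀ c i j, i ≤ j → j ≤ k → v i c ≤ v j c := by
    intro c i j hij
    induction j, hij using Nat.le_induction with
    | base => exact fun _ => le_rfl
    | succ j _ ih => exact fun hj => (ih (by omega)).trans (hv j (by omega) c)
  intro i _ j l s hs t ht hij hil hj hl hjl
  have point : ∀ (n : ℕ) (a : ℝ) (c : Fin 2),
      AffineMap.lineMap (v n) (v (n + 1)) a c = v n c + a * (v (n + 1) c - v n c) := by
    intro n a c
    simp [AffineMap.lineMap_apply]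
    ring
  have lower : ∀ c, v i c ≤ AffineMap.lineMap (v j) (v (j + 1)) s c := by
    intro c
    rw [point]
    have h1 := mono c i j hij hj.le
    have h2 := mul_nonneg hs.1 (sub_nonneg.2 (hv j hj c))
    linarith
  have upper : ∀ c, AffineMap.lineMap (v j) (v (j + 1)) s c ≤
      AffineMap.lineMap (v l) (v (l + 1)) t c := by
    intro c
    rw [point, point]
    have hjc := sub_nonneg.2 (hv j hj c)
    rcases hjl with hlt | ⟨rfl, hst⟩
    · have h1 := mono c (j + 1) l hlt hl.le
      have h2 := mul_nonneg ht.1 (sub_nonneg.2 (hv l hl c))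
      have h3 := mul_le_of_le_one_left hjc hs.2
      linarith
    · have h1 := mul_le_mul_of_nonneg_right hst hjc
      linarith
  rw [EuclideanSpace.dist_eq, EuclideanSpace.dist_eq]
  refine Real.sqrt_le_sqrt (Finset.sum_le_sum fun c _ => ?_)
  rw [Real.dist_eq, Real.dist_eq, sq_abs, sq_abs]
  have h1 := lower c
  have h2 := upper c
  nlinarith

/-! ### Edges in the quadrant -/

/-- Near a vertex, the underlying space of a finite complex is covered by the faces containing the
vertex. -/
theorem eventually_exists_face_of_mem_space {K : Geometry.SimplicialComplex ℝ Plane}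
    (hfin : K.faces.Finite) {v : Plane} (hv : v ∈ K.vertices) :
    ∀ᶠ p in nhds v, p ∈ K.space → ∃ s ∈ K.faces, v ∈ s ∧ p ∈ convexHull ℝ (s : Set Plane) := by
  have hclosed : IsClosed (⋃ s ∈ {s ∈ K.faces | v ∉ s}, convexHull ℝ (s : Set Plane)) :=
    (hfin.subset (Set.sep_subset _ _)).isClosed_biUnion
      fun s _ => (s.finite_toSet.isCompact_convexHull (𝕜 := ℝ)).isClosed
  have hnot : v ∉ ⋃ s ∈ {s ∈ K.faces | v ∉ s}, convexHull ℝ (s : Set Plane) := by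
    simp only [Set.mem_iUnion, not_exists]
    rintro s ⟨hs, hvs⟩ hmem
    have h := K.inter_subset_convexHull hv hs ⟨subset_convexHull ℝ _ (by simp), hmem⟩
    have hempty : ((({v} : Finset Plane) : Set Plane) ∩ s) = ∅ := by
      simpa using hvs
    rw [hempty, convexHull_empty] at h
    exact h
  filter_upwards [hclosed.isOpen_compl.mem_nhds hnot] with p hp hpK
  obtain ⟨s, hs, hps⟩ := Geometry.SimplicialComplex.mem_space_iff.1 hpK
  refine ⟨s, hs, ?_, hps⟩
  by_contra hvs
  exact hp (Set.mem_biUnion (show s ∈ {s ∈ K.faces | v ∉ s} from ⟨hs, hvs⟩) hps)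

/-- If a positive point of the diagonal is a nonnegative combination of two vectors at a non-obtuse
angle, then one of them with a nonzero coefficient lies in the closed first quadrant. -/
theorem nonneg_of_diagonal_eq_combination {p₀ p₁ q₀ q₁ α β t : ℝ} (hα : 0 < α) (hβ : 0 < β)
    (ht : 0 < t) (h₀ : α * p₀ + β * q₀ = t) (h₁ : α * p₁ + β * q₁ = t)
    (hpq : 0 ≤ p₀ * q₀ + p₁ * q₁) : (0 ≤ p₀ ∧ 0 ≤ p₁) ∨ (0 ≤ q₀ ∧ 0 ≤ q₁) := by
  -- Otherwise each vector has a negative coordinate, where the other must be positive. The signs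
  -- are then (-, +) and (+, -) in some order, and the inner product is negative.
  by_contra! hcon
  obtain ⟨hp, hq⟩ := hcon
  have pos : ∀ x y : ℝ, x < 0 → α * x + β * y = t → 0 < y := fun x y hx h =>
    pos_of_mul_pos_right (by nlinarith) hβ.le
  have pos' : ∀ x y : ℝ, y < 0 → α * x + β * y = t → 0 < x := fun x y hy h =>
    pos_of_mul_pos_right (by nlinarith) hα.le
  rcases lt_or_ge p₀ 0 with hp₀ | hp₀
  · have hq₀ := pos _ _ hp₀ h₀
    have hq₁ := hq hq₀.le
    have hp₁ := pos' _ _ hq₁ h₁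
    nlinarith [mul_neg_of_neg_of_pos hp₀ hq₀, mul_neg_of_pos_of_neg hp₁ hq₁]
  · have hp₁ := hp hp₀
    have hq₁ := pos _ _ hp₁ h₁
    have hq₀ : q₀ < 0 := by
      by_contra! h
      exact (hq h).not_gt hq₁
    have hp₀ := pos' _ _ hq₀ h₀
    nlinarith [mul_neg_of_neg_of_pos hp₁ hq₁, mul_neg_of_pos_of_neg hp₀ hq₀]

/-- In a non-obtuse triangulation every interior vertex has an edge in the closed first quadrant. -/
theorem exists_edge_in_quadrant {C : Set Plane} {K : Geometry.SimplicialComplex ℝ Plane}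
    (hK : IsTriangulationOf K C) (hobt : IsNonObtuse K) (v : K.vertices)
    (hv : (v : Plane) ∈ interior C) :
    ∃ u, (edgeGraph K).Adj v u ∧ ∀ c, (v : Plane) c ≤ (u : Plane) c := by
  classical
  have hlim : Filter.Tendsto (fun t : ℝ => (v : Plane) + t • !₂[(1 : ℝ), 1])
      (nhdsWithin 0 (Set.Ioi 0)) (nhds (v : Plane)) := by
    have h : Continuous fun t : ℝ => (v : Plane) + t • !₂[(1 : ℝ), 1] := by fun_prop
    simpa using (h.tendsto 0).mono_left nhdsWithin_le_nhds
  obtain ⟨t, ⟨hface, hint⟩, ht⟩ := ((hlim.eventually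
    ((eventually_exists_face_of_mem_space hK.1 v.2).and (isOpen_interior.mem_nhds hv))).and
    self_mem_nhdsWithin).exists
  rw [hK.2] at hface
  obtain ⟨s, hs, hvs, hp⟩ := hface (interior_subset hint)
  replace ht : 0 < t := ht
  suffices h : ∃ a ∈ s, a ≠ (v : Plane) ∧ ∀ c, (v : Plane) c ≤ a c by
    obtain ⟨a, has, hav, hle⟩ := h
    have hsub : ({(v : Plane), a} : Finset Plane) ⊆ s := by
      simp [Finset.insert_subset_iff, hvs, has]
    refine ⟨⟨a, K.down_closed hs (by simpa using has) (by simp)⟩, ⟨?_, _,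
      K.down_closed hs hsub (by simp), by simp⟩, hle⟩
    exact fun h => hav (congrArg Subtype.val h).symm
  obtain ⟨w, hw0, hw1, hws⟩ := Finset.mem_convexHull'.1 hp
  -- Relative to `v` the term of `v` vanishes: t(1, 1) is a nonnegative combination of the edge
  -- vectors from `v`.
  have hcomb : ∀ c, ∑ a ∈ s.erase (v : Plane), w a * (a c - (v : Plane) c) = t := by
    intro c
    have h1 := congrArg (fun p : Plane => p c) hws
    have h2 : ∑ a ∈ s, w a * (a c - (v : Plane) c) = t := by
      have h3 : ∑ a ∈ s, w a * (v : Plane) c = (v : Plane) c := by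
        rw [← Finset.sum_mul, hw1, one_mul]
      have h4 : ∑ a ∈ s, w a * a c = (v : Plane) c + t := by
        fin_cases c <;> simpa using h1
      simp only [mul_sub, Finset.sum_sub_distrib, h3, h4]
      ring
    rw [← Finset.add_sum_erase s _ hvs] at h2
    simpa using h2
  have hcard : (s.erase (v : Plane)).card ≤ 2 := by
    have h := (K.indep hs).card_le_finrank_succ
    have h' : Module.finrank ℝ (vectorSpan ℝ (Set.range ((↑) : s → Plane))) ≤ 2 := by
      simpa using Submodule.finrank_le (vectorSpan ℝ (Set.range ((↑) : s → Plane)))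
    rw [Finset.card_erase_of_mem hvs]
    rw [Fintype.card_coe] at h
    omega
  have single : ∀ a ∈ s.erase (v : Plane),
      (∀ c, w a * (a c - (v : Plane) c) = t) →
      ∃ a ∈ s, a ≠ (v : Plane) ∧ ∀ c, (v : Plane) c ≤ a c := by
    intro a ha h
    obtain ⟨hav, has⟩ := Finset.mem_erase.1 ha
    refine ⟨a, has, hav, fun c => ?_⟩
    have h2 : 0 < a c - (v : Plane) c :=
      pos_of_mul_pos_right ((h c).symm ▸ ht) (hw0 a has)
    linarith
  interval_cases hcase : (s.erase (v : Plane)).card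
  · rw [Finset.card_eq_zero] at hcase
    have h := hcomb 0
    rw [hcase, Finset.sum_empty] at h
    exact absurd h ht.ne
  · obtain ⟨a, ha⟩ := Finset.card_eq_one.1 hcase
    exact single a (by simp [ha]) fun c => by simpa [ha] using hcomb c
  · obtain ⟨a, b, hab, he⟩ := Finset.card_eq_two.1 hcase
    have hcomb' : ∀ c, w a * (a c - (v : Plane) c) + w b * (b c - (v : Plane) c) = t :=
      fun c => by simpa [he, Finset.sum_pair hab] using hcomb c
    have hae : a ∈ s.erase (v : Plane) := by simp [he]
    have hbe : b ∈ s.erase (v : Plane) := by simp [he]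
    obtain ⟨hav, has⟩ := Finset.mem_erase.1 hae
    obtain ⟨hbv, hbs⟩ := Finset.mem_erase.1 hbe
    rcases (hw0 a has).eq_or_lt with hwa | hwa
    · exact single b hbe fun c => by simpa [← hwa] using hcomb' c
    rcases (hw0 b hbs).eq_or_lt with hwb | hwb
    · exact single a hae fun c => by simpa [← hwb] using hcomb' c
    have hangle := hobt s hs a has v hvs b hbs hav hbv.symm hab
    rw [EuclideanGeometry.angle, InnerProductGeometry.angle, Real.arccos_le_pi_div_two,
      le_div_iff₀ (mul_pos (norm_pos_iff.2 (vsub_ne_zero.2 hav))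
        (norm_pos_iff.2 (vsub_ne_zero.2 hbv))), zero_mul] at hangle
    have hinner : 0 ≤ (a 0 - (v : Plane) 0) * (b 0 - (v : Plane) 0) +
        (a 1 - (v : Plane) 1) * (b 1 - (v : Plane) 1) := by
      simpa [PiLp.inner_apply, Fin.sum_univ_two, mul_comm] using hangle
    rcases nonneg_of_diagonal_eq_combination hwa hwb ht (hcomb' 0) (hcomb' 1) hinner with h | h
    · exact ⟨a, has, hav, Fin.forall_fin_two.2 ⟨by linarith, by linarith⟩⟩
    · exact ⟨b, hbs, hbv, Fin.forall_fin_two.2 ⟨by linarith, by linarith⟩⟩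

/-! ### Forests from parent functions -/

namespace SimpleGraph

variable {V : Type*} {G : SimpleGraph V} {B : Set V} {f : V → V} {h : V → ℝ}

theorem wellFounded_height [Finite V] (h : V → ℝ) : WellFounded fun w v => h v < h w := by
  have : IsTrans V fun w v => h v < h w := ⟨fun _ _ _ h₁ h₂ => h₂.trans h₁⟩
  have : Std.Irrefl fun w v : V => h v < h w := ⟨fun _ => lt_irrefl _⟩
  exact Finite.wellFounded_of_trans_of_irrefl _

/-- Following a parent function along which a height increases leads to a unique root. -/
theorem exists_rootMap [Finite V] (hlt : ∀ v ∉ B, h v < h (f v)) :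
    ∃ ρ : V → V, (∀ v ∈ B, ρ v = v) ∧ (∀ v ∉ B, ρ (f v) = ρ v) ∧ ∀ v, ρ v ∈ B := by
  classical
  let ρ : V → V := (wellFounded_height h).fix fun v ih =>
    if hv : v ∈ B then v else ih (f v) (hlt v hv)
  have hρ : ∀ v, ρ v = if v ∈ B then v else ρ (f v) := fun v => by
    rw [show ρ v = _ from WellFounded.fix_eq _ _ _]
    rfl
  refine ⟨ρ, fun v hv => by rw [hρ, if_pos hv], fun v hv => by rw [hρ v, if_neg hv], fun v => ?_⟩
  induction v using (wellFounded_height h).induction with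
  | _ v ih =>
    rw [hρ]
    split_ifs with hv
    exacts [hv, ih _ (hlt v hv)]

/-- The tree of all vertices with root `r`, along the edges from vertices to their parents. -/
def rootedTree (hadj : ∀ v ∉ B, G.Adj v (f v)) {ρ : V → V} (hρ : ∀ v ∉ B, ρ (f v) = ρ v) (r : V) :
    G.Subgraph where
  verts := {v | ρ v = r}
  Adj u v := ρ u = r ∧ ((u ∉ B ∧ f u = v) ∨ (v ∉ B ∧ f v = u))
  adj_sub := by
    rintro u v ⟨-, ⟨hu, rfl⟩ | ⟨hv, rfl⟩⟩
    exacts [hadj u hu, (hadj v hv).symm]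
  edge_vert := fun h => h.1
  symm := ⟨by
    rintro u v ⟨hr, ⟨hu, rfl⟩ | ⟨hv, rfl⟩⟩
    exacts [⟨(hρ u hu).trans hr, .inr ⟨hu, rfl⟩⟩, ⟨(hρ v hv).symm.trans hr, .inl ⟨hv, rfl⟩⟩]⟩

variable (hadj : ∀ v ∉ B, G.Adj v (f v)) {ρ : V → V} (hρ : ∀ v ∉ B, ρ (f v) = ρ v)

/-- Every vertex of the rooted tree is joined to the root by a path along the parent function. -/
theorem exists_path_rootedTree [Finite V] (hlt : ∀ v ∉ B, h v < h (f v)) (hB : ∀ v ∈ B, ρ v = v)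
    {r : V} (r' : (rootedTree hadj hρ r).verts) (hr : (r' : V) = r)
    (v : (rootedTree hadj hρ r).verts) :
    ∃ p : (rootedTree hadj hρ r).coe.Walk v r', p.IsPath ∧ (∀ w ∈ p.support, h v ≤ h w) ∧
      ∀ n < p.length, (p.getVert n : V) ∉ B ∧ f (p.getVert n) = p.getVert (n + 1) := by
  obtain ⟨v, hv⟩ := v
  induction v using (wellFounded_height h).induction with
  | _ v ih =>
    by_cases hvB : v ∈ B
    · obtain rfl : (⟨v, hv⟩ : (rootedTree hadj hρ r).verts) = r' :=
        Subtype.ext ((hB v hvB).symm.trans (Eq.trans hv hr.symm))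
      exact ⟨.nil, by simp, by simp, by simp⟩
    · obtain ⟨p, hp, hph, hpf⟩ := ih (f v) (hlt v hvB) ((hρ v hvB).trans hv)
      have hvf : (rootedTree hadj hρ r).coe.Adj ⟨v, hv⟩ ⟨f v, (hρ v hvB).trans hv⟩ :=
        ⟨hv, .inl ⟨hvB, rfl⟩⟩
      -- The rest of the path has height at least `h (f v)`, so it cannot return to `v`.
      refine ⟨.cons hvf p, hp.cons fun hmem => (hph _ hmem).not_gt (hlt v hvB), ?_, ?_⟩
      · intro w hw
        rw [Walk.support_cons, List.mem_cons] at hw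
        rcases hw with rfl | hw
        exacts [le_rfl, (hlt v hvB).le.trans (hph w hw)]
      · rintro (_ | n) hn
        · simpa using hvB
        · simpa using hpf n (by simpa using hn)

/-- Paths to the root give connectedness. Every edge joins some non-root vertex to its parent, so
there are fewer edges than vertices, and a connected graph with this property is a tree. -/
theorem isTree_rootedTree [Finite V] (hlt : ∀ v ∉ B, h v < h (f v)) (hB : ∀ v ∈ B, ρ v = v)
    {r : V} (hr : r ∈ B) : (rootedTree hadj hρ r).coe.IsTree := by
  classical
  set T := rootedTree hadj hρ r
  let r' : T.verts := ⟨r, hB r hr⟩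
  have hconn : T.coe.Connected := by
    have : Nonempty T.verts := ⟨r'⟩
    have hreach : ∀ v, T.coe.Reachable v r' := fun v =>
      (exists_path_rootedTree hadj hρ hlt hB r' rfl v).choose.reachable
    exact ⟨fun u v => (hreach u).trans (hreach v).symm⟩
  refine isTree_iff_connected_and_card.2 ⟨hconn, le_antisymm ?_
    hconn.card_vert_le_card_edgeSet_add_one⟩
  have hnB : ∀ v : T.verts, v ≠ r' → (v : V) ∉ B := fun v hv hvB =>
    hv (Subtype.ext ((hB v hvB).symm.trans v.2))
  let parentEdge : {v : T.verts // v ≠ r'} → T.coe.edgeSet := fun v =>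
    ⟨s(v.1, ⟨f v.1, (hρ _ (hnB v v.2)).trans v.1.2⟩), v.1.2, .inl ⟨hnB v v.2, rfl⟩⟩
  have hsurj : Function.Surjective parentEdge := by
    rintro ⟨e, he⟩
    induction e using Sym2.ind with
    | _ u v =>
      obtain ⟨-, ⟨hu, huv⟩ | ⟨hv, hvu⟩⟩ := he
      · refine ⟨⟨u, fun h => hu (h ▸ hr)⟩, Subtype.ext ?_⟩
        simp [parentEdge, huv]
      · refine ⟨⟨v, fun h => hv (h ▸ hr)⟩, Subtype.ext ?_⟩
        simp [parentEdge, hvu, Sym2.eq_swap]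
  have hcard := Nat.card_le_card_of_surjective parentEdge hsurj
  have hsum : Nat.card {v : T.verts // v ≠ r'} + 1 = Nat.card T.verts := by
    have := Fintype.ofFinite T.verts
    have := Fintype.card_pos_iff.2 ⟨r'⟩
    rw [Nat.card_eq_fintype_card, Nat.card_eq_fintype_card, Fintype.card_subtype_compl,
      Fintype.card_subtype_eq]
    omega
  omega

end SimpleGraph

/-! ### Assembling the forest -/

theorem mainTheorem1 (C : Set Plane) (K : Geometry.SimplicialComplex ℝ Plane)
    (hC : IsConvexDomain C) (hround : IsRound C)
    (hK : IsTriangulationOf K C) (hobt : IsNonObtuse K) :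
    ∃ F : Set (edgeGraph K).Subgraph, IsRadiallyMonotoneSpanningForest C K F := by
  have hclosed : IsClosed C := by
    obtain ⟨⟨S, rfl⟩, -⟩ := hC
    exact (S.finite_toSet.isCompact_convexHull (𝕜 := ℝ)).isClosed
  have hfin : Finite K.vertices := by
    have hinj : Function.Injective fun v : Plane => ({v} : Finset Plane) :=
      Finset.singleton_injective
    exact (hK.1.preimage hinj.injOn : K.vertices.Finite)
  let B : Set K.vertices := {v | (v : Plane) ∈ frontier C}
  have hint : ∀ v : K.vertices, v ∉ B → (v : Plane) ∈ interior C := by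
    intro v hv
    by_contra hvC
    have hmem : (v : Plane) ∈ C := hK.2 ▸ K.vertices_subset_space v.2
    exact hv ⟨subset_closure hmem, hvC⟩
  have hex : ∀ v : K.vertices, ∃ u, v ∉ B → (edgeGraph K).Adj v u ∧
      ∀ c, (v : Plane) c ≤ (u : Plane) c := by
    intro v
    by_cases hv : v ∈ B
    -- On the boundary the parent is a dummy value.
    · exact ⟨v, fun h => absurd hv h⟩
    · obtain ⟨u, hu⟩ := exists_edge_in_quadrant hK hobt v (hint v hv)
      exact ⟨u, fun _ => hu⟩
  choose f hf using hex
  let h : K.vertices → ℝ := fun v => (v : Plane) 0 + (v : Plane) 1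
  have hlt : ∀ v ∉ B, h v < h (f v) := by
    intro v hv
    obtain ⟨hadj, hle⟩ := hf v hv
    refine lt_of_le_of_ne (add_le_add (hle 0) (hle 1)) fun heq => hadj.1 (Subtype.ext ?_)
    have heq' : (v : Plane) 0 + (v : Plane) 1 = (f v : Plane) 0 + (f v : Plane) 1 := heq
    have h₀ := hle 0
    have h₁ := hle 1
    ext c
    fin_cases c
    · change (v : Plane) 0 = (f v : Plane) 0
      linarith
    · change (v : Plane) 1 = (f v : Plane) 1
      linarith
  have hadj : ∀ v ∉ B, (edgeGraph K).Adj v (f v) := fun v hv => (hf v hv).1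
  obtain ⟨ρ, hB, hρ, hρB⟩ := SimpleGraph.exists_rootMap hlt
  refine ⟨SimpleGraph.rootedTree hadj hρ '' B, ?_, ?_, fun v _ =>
    ⟨_, ⟨ρ v, hρB v, rfl⟩, rfl⟩⟩
  · rintro _ ⟨r, hr, rfl⟩
    have htree := SimpleGraph.isTree_rootedTree hadj hρ hlt hB hr
    refine ⟨⟨r, hB r hr⟩, htree, hr, fun w hw => Subtype.ext ((hB w hw).symm.trans w.2), ?_⟩
    intro v _ p hp
    obtain ⟨q, hq, -, hqf⟩ := SimpleGraph.exists_path_rootedTree hadj hρ hlt hB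
      (⟨r, hB r hr⟩ : (SimpleGraph.rootedTree hadj hρ r).verts) rfl v
    -- Paths in a tree are unique, so `p` is the path that follows parents.
    obtain rfl : p = q := congrArg Subtype.val ((htree.isAcyclic.subsingleton_path _ _).elim ⟨p, hp⟩ ⟨q, hq⟩)
    refine isRadiallyMonotone_of_coord_le fun n hn c => ?_
    obtain ⟨hnB, hfn⟩ := hqf n hn
    rw [← hfn]
    exact (hf _ hnB).2 c
  · rintro _ ⟨r, -, rfl⟩ _ ⟨r', -, rfl⟩ hne
    refine Set.disjoint_left.2 fun v hv hv' => hne ?_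
    rw [← show ρ v = r from hv, ← show ρ v = r' from hv']
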